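/- Let $\mathcal G=\{G^{(t)}\}_{t=1}^{\infty}$ be a sequence of connected, undirected, simple graphs on a common finite vertex set $V$ with $|V|=n$, and let $P^{(t)}$ be the transition matrix of the lazy random walk on $G^{(t)}$ (stay put with probability $1/2$, otherwise move to a uniformly random neighbour; if $n=1$ the walk stays put). Suppose that a single probability distribution $\pi$ on $V$ satisfies $\pi P^{(t)}=\pi$ for all $t$, and that every $G^{(t)}$ has at most $m^*$ edges. Put $\pi_*=\min_{u\in V}\pi_u$, and let $p^{[0,t]}_{u,v}=(P^{(1)}P^{(2)}\cdots P^{(t)})(u,v)$ be the probability that the walk on $\mathcal G$ started at $u$ at time $0$ is at $v$ at time $t$. Let $$t_{\mathsf{mix}}(\mathcal G)=\min\Bigl\{t\ge 0:\ \Bigl(\sum_{v\in V}\pi_v\Bigl(\frac{p^{[0,t]}_{u,v}}{\pi_v}-1\Bigr)^2\Bigr)^{1/2}\le \tfrac13\ \text{ for all } u\in V\Bigr\}$$ be the $\ell_2$ mixing time, and let $t_{\mathsf{hit}}(\mathcal G)$ be the maximum over $u,v\in V$ of the expected time at which the walk started at $u$ at time $0$ first visits $v$. Then there is an absolute constant $C>0$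 (independent of $\mathcal G$, $n$, $\pi$ and $m^*$) such that: 1. $t_{\mathsf{mix}}(\mathcal G)\le C\,\dfrac{n}{\pi_*}$. 2. For all $t\ge 1$ and $u,v\in V$, $\displaystyle\left|\frac{p^{[0,t]}_{u,v}}{\pi_v}-1\right|\le C\left(\frac{m^*}{t}+\frac{1}{\pi_*\sqrt t}\right)$. If moreover all graphs in $\mathcal G$ are $d$-regular for some $d$, then $\displaystyle\left|\frac{p^{[0,t]}_{u,v}}{\pi_v}-1\right|\le C\,\frac{n}{\sqrt t}$ for all $t\ge1$ and $u,v\in V$, with $C$ also independent of $d$. 3. $t_{\mathsf{hit}}(\mathcal G)\le C\,\dfrac{n\log n}{\pi_*}$. If moreover all graphs in $\mathcal G$ are $d$-regular for some $d$, then $t_{\mathsf{hit}}(\mathcal G)\le C\,n^2$. -/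

import Mathlib

open MeasureTheory ProbabilityTheory
open scoped ENNReal

namespace DynamicWalk

noncomputable section

/-- Transition matrix of the lazy random walk on a finite graph: stay with probability `1/2`,
otherwise move to a uniformly random neighbour. (An isolated vertex, which in a connected graph
exists only if the graph has a single vertex, is never left.) -/
def lazyMatrix {V : Type*} [Fintype V] [DecidableEq V] (G : SimpleGraph V) [DecidableRel G.Adj] :
    Matrix V V ℝ :=
  Matrix.of fun u v =>
    if u = v then (if G.degree u = 0 then 1 else 1 / 2)
    else if G.Adj u v then 1 / (2 * (G.degree u : ℝ))
    else 0

theorem lazyMatrix_nonneg {V : Type*} [Fintype V] [DecidableEq V] (G : SimpleGraph V)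
    [DecidableRel G.Adj] (u v : V) : 0 ≤ lazyMatrix G u v := by
  simp only [lazyMatrix, Matrix.of_apply]
  split_ifs <;> positivity

theorem lazyMatrix_row_sum {V : Type*} [Fintype V] [DecidableEq V] (G : SimpleGraph V)
    [DecidableRel G.Adj] (u : V) : ∑ v, lazyMatrix G u v = 1 := by
  have h : ∀ v, lazyMatrix G u v =
      (if u = v then (if G.degree u = 0 then (1 : ℝ) else 1 / 2) else 0) +
        (if v ∈ G.neighborFinset u then 1 / (2 * (G.degree u : ℝ)) else 0) := by
    intro v
    simp only [lazyMatrix, Matrix.of_apply]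
    by_cases huv : u = v
    · subst huv
      simp
    · simp [huv]
  simp_rw [h]
  rw [Finset.sum_add_distrib, Finset.sum_ite_eq, Finset.sum_ite_mem, Finset.univ_inter,
    Finset.sum_const, SimpleGraph.card_neighborFinset_eq_degree]
  by_cases hd : G.degree u = 0
  · simp [hd]
  · have : (G.degree u : ℝ) ≠ 0 := by exact_mod_cast hd
    simp only [Finset.mem_univ, if_true, hd, if_false, nsmul_eq_mul]
    field_simp
    norm_num

/-- The `t`-step transition matrix `P⁽¹⁾ ⋯ P⁽ᵗ⁾`, whose `(u, v)` entry is the probability that the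
walk started at `u` at time `0` is at `v` at time `t`. The graph used in the step from time `t` to
time `t + 1` is `G t` (so the sequence is indexed from `0`). -/
def transProb {V : Type*} [Fintype V] [DecidableEq V] (G : ℕ → SimpleGraph V)
    [∀ t, DecidableRel (G t).Adj] : ℕ → Matrix V V ℝ
  | 0 => 1
  | t + 1 => transProb G t * lazyMatrix (G t)

/-- `π` is a probability distribution that is stationary for the lazy walk on `G`. -/
def IsStationary {V : Type*} [Fintype V] [DecidableEq V] (G : SimpleGraph V)
    [DecidableRel G.Adj] (π : V → ℝ) : Prop :=
  π ∈ stdSimplex ℝ V ∧ Matrix.vecMul π (lazyMatrix G) = π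

/-- The smallest value `π_* = min_u π u`. -/
def minMass {V : Type*} (π : V → ℝ) : ℝ := ⨅ u, π u

/-- The norm of `ℓ₂(π)`. -/
def l2norm {V : Type*} [Fintype V] (π f : V → ℝ) : ℝ := √(∑ u, f u ^ 2 * π u)

/-- The `ℓ₂` mixing time: the least `t` such that, from every starting vertex, the likelihood ratio
at time `t` is within `1/3` of the constant `1` in `ℓ₂(π)` (and `∞` if there is no such `t`). -/
def mixingTime {V : Type*} [Fintype V] [DecidableEq V] (G : ℕ → SimpleGraph V)
    [∀ t, DecidableRel (G t).Adj] (π : V → ℝ) : ℝ≥0∞ :=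
  ⨅ (t : ℕ) (_ : ∀ u, l2norm π (fun v => transProb G t u v / π v - 1) ≤ 1 / 3), (t : ℝ≥0∞)

/-- One step of the lazy walk from `u`, as a probability distribution on the vertices. -/
def lazyStep {V : Type*} [Fintype V] [DecidableEq V] (G : SimpleGraph V) [DecidableRel G.Adj]
    (u : V) : PMF V :=
  PMF.ofFintype (fun v => ENNReal.ofReal (lazyMatrix G u v)) (by
    rw [← ENNReal.ofReal_sum_of_nonneg fun v _ => lazyMatrix_nonneg G u v, lazyMatrix_row_sum,
      ENNReal.ofReal_one])

/-- The conditional law of the position at time `t + 1` given the positions up to time `t`. -/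
def stepKernel {V : Type*} [Fintype V] [DecidableEq V] [MeasurableSpace V]
    [DiscreteMeasurableSpace V] (G : ℕ → SimpleGraph V) [∀ t, DecidableRel (G t).Adj] (t : ℕ) :
    Kernel ((_ : Finset.Iic t) → V) V :=
  Kernel.ofFunOfCountable fun h => (lazyStep (G t) (h ⟨t, Finset.mem_Iic.2 le_rfl⟩)).toMeasure

instance {V : Type*} [Fintype V] [DecidableEq V] [MeasurableSpace V]
    [DiscreteMeasurableSpace V] (G : ℕ → SimpleGraph V) [∀ t, DecidableRel (G t).Adj] (t : ℕ) :
    IsMarkovKernel (stepKernel G t) :=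
  ⟨fun h => PMF.toMeasure.isProbabilityMeasure
    (lazyStep (G t) (h ⟨t, Finset.mem_Iic.2 le_rfl⟩))⟩

/-- The law, on the space of trajectories, of the lazy random walk on the sequence `G` that starts
at `u` at time `0`. -/
def walkLaw {V : Type*} [Fintype V] [DecidableEq V] [MeasurableSpace V]
    [DiscreteMeasurableSpace V] (G : ℕ → SimpleGraph V) [∀ t, DecidableRel (G t).Adj] (u : V) :
    Measure (ℕ → V) :=
  Kernel.traj (X := fun _ => V) (stepKernel G) 0 (fun _ => u)

/-- The first time at which the trajectory `ω` is at `v` (`∞` if it never is). -/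
def firstHit {V : Type*} (v : V) (ω : ℕ → V) : ℝ≥0∞ :=
  ⨅ (t : ℕ) (_ : ω t = v), (t : ℝ≥0∞)

/-- The expected time that the walk started at `u` needs to reach `v`. -/
def hittingTime {V : Type*} [Fintype V] [DecidableEq V] [MeasurableSpace V]
    [DiscreteMeasurableSpace V] (G : ℕ → SimpleGraph V) [∀ t, DecidableRel (G t).Adj] (u v : V) :
    ℝ≥0∞ :=
  ∫⁻ ω, firstHit v ω ∂(walkLaw G u)

/-- The maximum hitting time. -/
def maxHittingTime {V : Type*} [Fintype V] [DecidableEq V] [MeasurableSpace V]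
    [DiscreteMeasurableSpace V] (G : ℕ → SimpleGraph V) [∀ t, DecidableRel (G t).Adj] : ℝ≥0∞ :=
  ⨆ (u : V) (v : V), hittingTime G u v

end

end DynamicWalk

/-!
Since the common stationary distribution `π` is proportional to the degrees in each graph, every
step is reversible with respect to `π`, and the density `f = p / π` of the walk evolves by applying
the transition matrices to it as a function. Everything rests on how fast the squared distance
`y = ‖f - 1‖²` in `ℓ₂(π)` decreases. By laziness, one step takes away at least the Dirichlet form of
`f` (`IsReversible.sum_sq_sub_le`). Let `1 + M` be the maximum of `f`, attained at `u`, and `k` the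
number of vertices where `f > 1 + M / 2`. Either at least half of the neighbours of `u` see a drop
by `M / 2`, or `k` exceeds half the degree of `u`, and then a geodesic from `u` to the nearest vertex
with such a drop has length at most `5 k / δ`, where `δ` is the least degree
(`degree_mul_sq_le_energy`). In both cases the loss is at least `π_* M² / (80 k)`. Now `y ≤ M`, as
`y` is a mean of `f - 1`; also `k ≤ n`, and `k π_* M ≤ 2` by Markov's inequality. So a step decreases
`y` by at least `π_* y² / (80 n)` and by at least `π_*² y³ / 160` (`IsStationary.isContracting`),
which integrates to `y ≤ 80 n / (π_* t)` and `y² ≤ 80 / (π_*² t)` (`chiSq_decay`).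

The first bound at `t` of order `n / π_*` is the bound on the mixing time. The walk read backwards
obeys the same bounds, and a transition probability is an inner product of a forward and a backward
half, so that `|p / π - 1|` is at most of order `n / (π_* t)` and of order `1 / (π_* √t)`
(`abs_stepProd_div_sub_one_decay`). The second rate is better than the one claimed, which has the
additional term `m / t`; for regular graphs `1 / π_* = n`.

For hitting times, compare in a window of length `s` the expected number of visits to `v`, of order
`π v * s` once `s` is twice the time for uniform mixing, with the expected number of visits
from the first one on (`sum_stepProd_le`). By the decay of the return probabilities the latter is of
order `π v * s` too if `s` is of order `n log n / π_*`, or `n²` for regular graphs. So each window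
contains a visit with probability at least `1 / 16` (`sum_avoidProb_le_of_decay`), and the waiting
time has mean at most `16 s`. The probabilities of avoiding `v`, defined by recursion over the first
step, are tied to the law on trajectories in `traj_avoidSet_le`.
-/

namespace DynamicWalk

/-! ### Geodesics and the energy of a function on a graph -/

/-- The sum of `(f a - f b) ^ 2` over the ordered pairs of adjacent vertices, that is, twice the
Dirichlet energy of `f` on the graph with unit edge weights. -/
noncomputable def energy {V : Type*} [Fintype V] (G : SimpleGraph V) [DecidableRel G.Adj]
    (f : V → ℝ) : ℝ :=
  ∑ a, ∑ b, if G.Adj a b then (f a - f b) ^ 2 else 0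

section Graph

variable {V : Type*} [Fintype V] (G : SimpleGraph V) [DecidableRel G.Adj]

theorem sum_le_energy (f : V → ℝ) (s : Finset (V × V)) (hs : ∀ p ∈ s, G.Adj p.1 p.2) :
    ∑ p ∈ s, (f p.1 - f p.2) ^ 2 ≤ energy G f := by
  rw [energy, ← Fintype.sum_prod_type' (fun a b => if G.Adj a b then (f a - f b) ^ 2 else 0)]
  calc ∑ p ∈ s, (f p.1 - f p.2) ^ 2
      = ∑ p ∈ s, if G.Adj p.1 p.2 then (f p.1 - f p.2) ^ 2 else 0 :=
        Finset.sum_congr rfl fun p hp => by rw [if_pos (hs p hp)]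
    _ ≤ _ := Finset.sum_le_sum_of_subset_of_nonneg (Finset.subset_univ s) fun p _ _ => by
        split_ifs <;> positivity

variable {G}

/-- A geodesic that runs inside a set `S`, except for its endpoint, is short: the neighbourhoods of
its vertices, up to the last two, lie in `S`, and no vertex is in more than three of them. -/
theorem length_mul_le_of_geodesic {u x : V} (p : G.Walk u x) (hp : p.length = G.dist u x)
    (hG : G.Connected) {δ : ℕ} (hδ : ∀ w, δ ≤ G.degree w) (S : Finset V)
    (hS : ∀ w, G.dist u w < G.dist u x → w ∈ S) :
    (p.length - 1) * δ ≤ 3 * S.card := by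
  have hd : ∀ i ≤ p.length, G.dist u (p.getVert i) = i := fun i hi => by
    rw [← SimpleGraph.length_eq_dist_of_subwalk hp (p.isSubwalk_take i),
      SimpleGraph.Walk.take_length, min_eq_left hi]
  calc (p.length - 1) * δ = ∑ i ∈ Finset.range (p.length - 1), δ := by simp
    _ ≤ ∑ i ∈ Finset.range (p.length - 1),
          (Finset.bipartiteAbove (fun i w => G.Adj (p.getVert i) w) S i).card := by
        refine Finset.sum_le_sum fun i hi => (hδ (p.getVert i)).trans ?_
        rw [← SimpleGraph.card_neighborFinset_eq_degree]
        refine Finset.card_le_card fun w hw => ?_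
        have hw : G.Adj (p.getVert i) w := by simpa using hw
        have hi := Finset.mem_range.1 hi
        refine (Finset.mem_bipartiteAbove _).2 ⟨hS w ?_, hw⟩
        have h1 := hG.dist_triangle (u := u) (v := p.getVert i) (w := w)
        rw [hd i (by omega), SimpleGraph.dist_eq_one_iff_adj.2 hw] at h1
        omega
    _ = ∑ w ∈ S, (Finset.bipartiteBelow (fun i w => G.Adj (p.getVert i) w)
          (Finset.range (p.length - 1)) w).card :=
        Finset.sum_card_bipartiteAbove_eq_sum_card_bipartiteBelow _
    _ ≤ ∑ w ∈ S, 3 := by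
        refine Finset.sum_le_sum fun w _ => ?_
        calc _ ≤ (Finset.Icc (G.dist u w - 1) (G.dist u w + 1)).card := by
              refine Finset.card_le_card fun i hi => ?_
              obtain ⟨hi, hw⟩ := (Finset.mem_bipartiteBelow _).1 hi
              have hi := Finset.mem_range.1 hi
              have h0 := hd i (by omega)
              have h1 := hG.dist_triangle (u := u) (v := p.getVert i) (w := w)
              have h2 := hG.dist_triangle (u := u) (v := w) (w := p.getVert i)
              rw [h0, SimpleGraph.dist_eq_one_iff_adj.2 hw] at h1
              rw [h0, SimpleGraph.dist_eq_one_iff_adj.2 hw.symm] at h2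
              rw [Finset.mem_Icc]
              omega
          _ ≤ 3 := by rw [Nat.card_Icc]; omega
    _ = 3 * S.card := by simp [mul_comm]

theorem sq_sub_le_length_mul_energy [DecidableEq V] {u x : V} (p : G.Walk u x) (hp : p.length = G.dist u x)
    (f : V → ℝ) : (f u - f x) ^ 2 ≤ p.length * energy G f := by
  have hinj : Set.InjOn p.getVert (Finset.range p.length : Set ℕ) := by
    intro i hi j hj hij
    have hd : ∀ i ≤ p.length, G.dist u (p.getVert i) = i := fun i hi => by
      rw [← SimpleGraph.length_eq_dist_of_subwalk hp (p.isSubwalk_take i),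
        SimpleGraph.Walk.take_length, min_eq_left hi]
    have hi := Finset.mem_range.1 (Finset.mem_coe.1 hi)
    have hj := Finset.mem_range.1 (Finset.mem_coe.1 hj)
    rw [← hd i hi.le, ← hd j hj.le, hij]
  calc (f u - f x) ^ 2
      = (∑ i ∈ Finset.range p.length, (f (p.getVert i) - f (p.getVert (i + 1)))) ^ 2 := by
        rw [Finset.sum_range_sub', p.getVert_zero, p.getVert_length]
    _ ≤ p.length * ∑ i ∈ Finset.range p.length, (f (p.getVert i) - f (p.getVert (i + 1))) ^ 2 := by
        simpa using sq_sum_le_card_mul_sum_sq (s := Finset.range p.length)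
          (f := fun i => f (p.getVert i) - f (p.getVert (i + 1)))
    _ ≤ p.length * energy G f := by
        gcongr
        refine le_trans (le_of_eq ?_) (sum_le_energy G f
          ((Finset.range p.length).image fun i => (p.getVert i, p.getVert (i + 1))) ?_)
        · rw [Finset.sum_image]
          exact fun i hi j hj hij => hinj hi hj (Prod.ext_iff.1 hij).1
        · intro q hq
          obtain ⟨i, hi, rfl⟩ := Finset.mem_image.1 hq
          exact p.adj_getVert_succ (Finset.mem_range.1 hi)

/-- The isoperimetric heart of the argument. A function that drops by `h` from its value at `u`
has large energy as soon as only few vertices see a drop of less than `h`. If these are at most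
half as many as the neighbours of `u`, the edges at `u` account for the energy; otherwise a
geodesic from `u` to the nearest vertex with a drop of `h` does. -/
theorem degree_mul_sq_le_energy [DecidableEq V] (hG : G.Connected) (f : V → ℝ) (u : V) {h : ℝ} (hh : 0 < h)
    {δ : ℕ} (hδ : ∀ w, δ ≤ G.degree w) (hx : ∃ x, f x ≤ f u - h) :
    δ * h ^ 2 ≤ 5 * (Finset.univ.filter fun x => f u - h < f x).card * energy G f := by
  set S := Finset.univ.filter fun x => f u - h < f x with hSdef
  have hE : 0 ≤ energy G f := by
    simpa using sum_le_energy G f ∅ (by simp)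
  have huS : u ∈ S := by simp [hSdef, hh]
  have hk : 1 ≤ S.card := Finset.card_pos.2 ⟨u, huS⟩
  have hdrop : ∀ x, x ∉ S → h ^ 2 ≤ (f u - f x) ^ 2 := fun x hxS => by
    have : f x ≤ f u - h := by simpa [hSdef] using hxS
    exact pow_le_pow_left₀ hh.le (by linarith) 2
  by_cases hcase : 2 * S.card ≤ G.degree u
  · have h1 := sum_le_energy G f ((G.neighborFinset u \ S).image fun w => (u, w)) (by
      intro q hq
      obtain ⟨w, hw, rfl⟩ := Finset.mem_image.1 hq
      simpa using (Finset.mem_sdiff.1 hw).1)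
    rw [Finset.sum_image (fun a _ b _ hab => (Prod.ext_iff.1 hab).2)] at h1
    have h2 : ((G.neighborFinset u \ S).card : ℝ) * h ^ 2
        ≤ ∑ w ∈ G.neighborFinset u \ S, (f u - f w) ^ 2 := by
      rw [← nsmul_eq_mul]
      exact Finset.card_nsmul_le_sum _ _ _ fun w hw => hdrop w (Finset.mem_sdiff.1 hw).2
    have h3 : δ ≤ 2 * (G.neighborFinset u \ S).card := by
      have := Finset.le_card_sdiff S (G.neighborFinset u)
      rw [SimpleGraph.card_neighborFinset_eq_degree] at this
      have := hδ u
      omega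
    have h3' : (δ : ℝ) ≤ 2 * ((G.neighborFinset u \ S).card : ℝ) := by exact_mod_cast h3
    have hk' : (1 : ℝ) ≤ S.card := by exact_mod_cast hk
    have h4 : (δ : ℝ) * h ^ 2 ≤ 2 * energy G f := by
      nlinarith [sq_nonneg h]
    nlinarith
  · have hne : (Finset.univ \ S).Nonempty := by
      obtain ⟨x, hx⟩ := hx
      exact ⟨x, by simpa [hSdef] using hx⟩
    obtain ⟨x, hxS, hmin⟩ := Finset.exists_min_image (Finset.univ \ S) (fun x => G.dist u x) hne
    have hxS := (Finset.mem_sdiff.1 hxS).2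
    obtain ⟨p, hp⟩ := hG.exists_walk_length_eq_dist u x
    have hlen := length_mul_le_of_geodesic p hp hG hδ S fun w hw => by
      by_contra hwS
      exact absurd (hmin w (by simp [hwS])) (not_le.2 hw)
    have h5 : p.length * δ ≤ 5 * S.card := by
      have := hδ u
      have h6 : p.length * δ ≤ (p.length - 1) * δ + δ := by
        rw [← Nat.succ_mul]
        exact Nat.mul_le_mul_right _ (by omega)
      omega
    have h5' : (p.length : ℝ) * δ ≤ 5 * S.card := by exact_mod_cast h5
    have h7 := (hdrop x hxS).trans (sq_sub_le_length_mul_energy p hp f)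
    calc (δ : ℝ) * h ^ 2 ≤ δ * (p.length * energy G f) := by gcongr
      _ = (p.length * δ) * energy G f := by ring
      _ ≤ 5 * S.card * energy G f := by gcongr

/-- A stationary distribution is proportional to the degree: `π / degree` is harmonic, hence
constant. -/
theorem IsStationary.exists_eq_mul_degree [DecidableEq V] [Nontrivial V] (hG : G.Connected) {π : V → ℝ}
    (h : IsStationary G π) : ∃ c : ℝ, 0 < c ∧ ∀ u, π u = c * G.degree u := by
  have hd : ∀ u, (0 : ℝ) < G.degree u := fun u => by
    exact_mod_cast hG.preconnected.degree_pos_of_nontrivial u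
  have hharm : (G.lapMatrix ℝ).mulVec (fun u => π u / G.degree u) = 0 := by
    ext v
    rw [SimpleGraph.lapMatrix_mulVec_apply, Pi.zero_apply]
    have hv := congrFun h.2 v
    have hterm : ∀ u, π u * lazyMatrix G u v = (if u = v then π u / 2 else 0)
        + (if u ∈ G.neighborFinset v then π u / G.degree u / 2 else 0) := fun u => by
      have := (hd u).ne'
      by_cases huv : u = v
      · subst huv
        have h0 : G.degree u ≠ 0 := by exact_mod_cast this
        simp [lazyMatrix, h0]
        ring
      · by_cases hadj : G.Adj u v
        · simp [lazyMatrix, huv, hadj, hadj.symm]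
          field_simp
        · have : ¬ G.Adj v u := fun h => hadj h.symm
          simp [lazyMatrix, huv, hadj, this]
    simp only [Matrix.vecMul, dotProduct, hterm] at hv
    rw [Finset.sum_add_distrib, Finset.sum_ite_eq' Finset.univ v, if_pos (Finset.mem_univ v),
      Finset.sum_ite_mem, Finset.univ_inter, ← Finset.sum_div] at hv
    have := (hd v).ne'
    rw [mul_div_cancel₀ _ this]
    linarith
  rw [SimpleGraph.lapMatrix_mulVec_eq_zero_iff_forall_reachable] at hharm
  obtain ⟨u₀⟩ := hG.nonempty
  have hc : ∀ u, π u = π u₀ / G.degree u₀ * G.degree u := fun u => by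
    rw [hharm u₀ u (hG.preconnected u₀ u), div_mul_cancel₀ _ (hd u).ne']
  refine ⟨_, (div_nonneg (h.1.1 u₀) (hd u₀).le).lt_of_ne fun h0 => ?_, hc⟩
  have hzero : ∀ u, π u = 0 := fun u => by rw [hc u, ← h0, zero_mul]
  simpa [hzero] using h.1.2

end Graph

/-! ### Dissipation in one step of the lazy walk -/

section Step

variable {V : Type*} [Fintype V]

/-- The squared distance in `ℓ₂(π)` between `f` and the constant `1`. -/
def chiSq (π f : V → ℝ) : ℝ := ∑ u, (f u - 1) ^ 2 * π u

/-- `f` is the density with respect to `π` of a probability distribution. -/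
structure IsDensity (π f : V → ℝ) : Prop where
  nonneg : ∀ u, 0 ≤ f u
  sum_mul_eq_one : ∑ u, f u * π u = 1

/-- `P` is a stochastic matrix that is reversible with respect to `π`. -/
structure IsReversible (π : V → ℝ) (P : Matrix V V ℝ) : Prop where
  nonneg : ∀ u v, 0 ≤ P u v
  row_sum : ∀ u, ∑ v, P u v = 1
  detailed_balance : ∀ u v, π u * P u v = π v * P v u

/-- A reversible stochastic matrix that contracts the `ℓ₂(π)`-distance of every density to
equilibrium by a definite amount, once quadratic and once cubic in that squared distance. -/
structure IsContracting (π : V → ℝ) (P : Matrix V V ℝ) : Prop extends IsReversible π P where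
  quadratic : ∀ f, IsDensity π f → minMass π * chiSq π f ^ 2
    ≤ 80 * Fintype.card V * (chiSq π f - chiSq π (P.mulVec f))
  cubic : ∀ f, IsDensity π f → minMass π ^ 2 * chiSq π f ^ 3
    ≤ 160 * (chiSq π f - chiSq π (P.mulVec f))

theorem minMass_le (π : V → ℝ) (u : V) : minMass π ≤ π u :=
  ciInf_le (Set.finite_range π).bddBelow u

theorem chiSq_nonneg {π : V → ℝ} (hπ : ∀ u, 0 ≤ π u) (f : V → ℝ) : 0 ≤ chiSq π f :=
  Finset.sum_nonneg fun u _ => mul_nonneg (sq_nonneg _) (hπ u)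

theorem IsReversible.sum_mul_mulVec {π : V → ℝ} {P : Matrix V V ℝ} (hP : IsReversible π P)
    (f : V → ℝ) : ∑ u, π u * ∑ v, P u v * f v = ∑ v, f v * π v := by
  simp_rw [Finset.mul_sum]
  rw [Finset.sum_comm]
  refine Finset.sum_congr rfl fun v _ => ?_
  calc ∑ u, π u * (P u v * f v) = ∑ u, (π v * f v) * P v u :=
        Finset.sum_congr rfl fun u _ => by rw [← mul_assoc, hP.detailed_balance u v]; ring
    _ = f v * π v := by rw [← Finset.mul_sum, hP.row_sum]; ring

theorem IsDensity.mulVec {π : V → ℝ} {P : Matrix V V ℝ} (hP : IsReversible π P) {f : V → ℝ}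
    (hf : IsDensity π f) : IsDensity π (P.mulVec f) where
  nonneg u := Finset.sum_nonneg fun v _ => mul_nonneg (hP.nonneg u v) (hf.nonneg v)
  sum_mul_eq_one := by
    rw [← hf.sum_mul_eq_one, ← hP.sum_mul_mulVec f]
    exact Finset.sum_congr rfl fun u _ => mul_comm _ _

/-- For a lazy chain one step decreases the `ℓ₂(π)`-distance to equilibrium by at least the
Dirichlet form: at each vertex the variance of `f` under the step is at least half of the second
moment of the increment, since the increment vanishes with probability `1/2`. -/
theorem IsReversible.sum_sq_sub_le [DecidableEq V] {π : V → ℝ} (hπ : ∀ u, 0 ≤ π u)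
    {P : Matrix V V ℝ} (hP : IsReversible π P) (hlazy : ∀ u, 1 / 2 ≤ P u u) (f : V → ℝ) :
    1 / 2 * ∑ u, ∑ v, π u * P u v * (f u - f v) ^ 2
      ≤ chiSq π f - chiSq π (P.mulVec f) := by
  have hloc : ∀ u, 1 / 2 * ∑ v, P u v * (f u - f v) ^ 2
      ≤ ∑ v, P u v * (f v - 1) ^ 2 - (P.mulVec f u - 1) ^ 2 := by
    intro u
    have hB : P.mulVec f u - 1 = ∑ v, P u v * (f v - 1) := by
      simp only [mul_sub, Finset.sum_sub_distrib, mul_one, hP.row_sum, Matrix.mulVec, dotProduct]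
    have hx1 : ∑ v, P u v * (f v - f u) = (P.mulVec f u - 1) - (f u - 1) := by
      simp only [mul_sub, Finset.sum_sub_distrib, ← Finset.sum_mul, hP.row_sum, Matrix.mulVec,
        dotProduct]
      ring
    have hx2 : ∑ v, P u v * (f u - f v) ^ 2
        = ∑ v, P u v * (f v - 1) ^ 2 - 2 * (f u - 1) * (P.mulVec f u - 1) + (f u - 1) ^ 2 := by
      rw [hB, Finset.mul_sum, ← Finset.sum_sub_distrib,
        ← one_mul ((f u - 1) ^ 2), ← hP.row_sum u, Finset.sum_mul, ← Finset.sum_add_distrib]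
      exact Finset.sum_congr rfl fun v _ => by ring
    have herase : ∑ v ∈ Finset.univ.erase u, P u v ≤ 1 / 2 := by
      have := Finset.add_sum_erase Finset.univ (P u) (Finset.mem_univ u)
      rw [hP.row_sum] at this
      linarith [hlazy u]
    have hx3 : (∑ v, P u v * (f v - f u)) ^ 2 ≤ 1 / 2 * ∑ v, P u v * (f u - f v) ^ 2 := by
      rw [← Finset.add_sum_erase Finset.univ (fun v => P u v * (f v - f u)) (Finset.mem_univ u),
        ← Finset.add_sum_erase Finset.univ (fun v => P u v * (f u - f v) ^ 2) (Finset.mem_univ u)]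
      simp only [sub_self, mul_zero, zero_add, ne_eq, OfNat.ofNat_ne_zero, not_false_eq_true,
        zero_pow]
      have hnn : ∀ v, 0 ≤ P u v * (f u - f v) ^ 2 := fun v =>
        mul_nonneg (hP.nonneg u v) (sq_nonneg _)
      refine (Finset.sum_sq_le_sum_mul_sum_of_sq_le_mul (Finset.univ.erase u)
        (f := P u) (g := fun v => P u v * (f u - f v) ^ 2) (fun v _ => hP.nonneg u v)
        (fun v _ => hnn v) (fun v _ => le_of_eq (by ring))).trans ?_
      exact mul_le_mul_of_nonneg_right herase (Finset.sum_nonneg fun v _ => hnn v)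
    rw [hx1] at hx3
    nlinarith
  have hstat : chiSq π f = ∑ u, π u * ∑ v, P u v * (f v - 1) ^ 2 :=
    (hP.sum_mul_mulVec fun v => (f v - 1) ^ 2).symm
  rw [hstat, chiSq, ← Finset.sum_sub_distrib, Finset.mul_sum]
  refine Finset.sum_le_sum fun u _ => ?_
  calc 1 / 2 * ∑ v, π u * P u v * (f u - f v) ^ 2
      = π u * (1 / 2 * ∑ v, P u v * (f u - f v) ^ 2) := by
        simp_rw [mul_assoc, ← Finset.mul_sum]; ring
    _ ≤ π u * (∑ v, P u v * (f v - 1) ^ 2 - (P.mulVec f u - 1) ^ 2) :=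
        mul_le_mul_of_nonneg_left (hloc u) (hπ u)
    _ = _ := by ring

/-- The squared `ℓ₂(π)`-distance of a density to `1` is at most the excess of its maximum over `1`,
because it is the mean of `f - 1` under the distribution with density `f`. -/
theorem IsDensity.chiSq_le {π f : V → ℝ} (hπ : ∀ u, 0 ≤ π u) (hsum : ∑ u, π u = 1)
    (hf : IsDensity π f) {M : ℝ} (hM : ∀ u, f u ≤ 1 + M) : chiSq π f ≤ M := by
  calc chiSq π f = ∑ u, ((f u * π u) * (f u - 1) - f u * π u + π u) :=
        Finset.sum_congr rfl fun u _ => by ring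
    _ = ∑ u, (f u * π u) * (f u - 1) := by
        rw [Finset.sum_add_distrib, Finset.sum_sub_distrib, hf.sum_mul_eq_one, hsum]; ring
    _ ≤ ∑ u, (f u * π u) * M := Finset.sum_le_sum fun u _ =>
        mul_le_mul_of_nonneg_left (by linarith [hM u]) (mul_nonneg (hf.nonneg u) (hπ u))
    _ = M := by rw [← Finset.sum_mul, hf.sum_mul_eq_one, one_mul]

variable [DecidableEq V] {G : SimpleGraph V} [DecidableRel G.Adj] {π : V → ℝ}

theorem IsStationary.isReversible (hG : G.Connected) (h : IsStationary G π) :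
    IsReversible π (lazyMatrix G) where
  nonneg := lazyMatrix_nonneg G
  row_sum := lazyMatrix_row_sum G
  detailed_balance u v := by
    rcases eq_or_ne u v with rfl | huv
    · rfl
    have : Nontrivial V := ⟨u, v, huv⟩
    obtain ⟨c, -, hc⟩ := h.exists_eq_mul_degree hG
    have hd : ∀ u, (G.degree u : ℝ) ≠ 0 := fun u => by
      exact_mod_cast (hG.preconnected.degree_pos_of_nontrivial u).ne'
    have := hd u
    have := hd v
    by_cases hadj : G.Adj u v
    · simp only [lazyMatrix, Matrix.of_apply, huv, huv.symm, hadj, hadj.symm, if_true, if_false, hc]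
      field_simp
    · have hadj' : ¬ G.Adj v u := fun h => hadj h.symm
      simp [lazyMatrix, huv, huv.symm, hadj, hadj']

theorem IsStationary.pos (hG : G.Connected) (h : IsStationary G π) (u : V) : 0 < π u := by
  rcases subsingleton_or_nontrivial V with hV | hV
  · have hs := h.1.2
    rw [Fintype.sum_eq_single u fun v hv => (hv (Subsingleton.elim v u)).elim] at hs
    rw [hs]; exact one_pos
  · obtain ⟨c, hc0, hc⟩ := h.exists_eq_mul_degree hG
    rw [hc]
    exact mul_pos hc0 (by exact_mod_cast hG.preconnected.degree_pos_of_nontrivial u)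

/-- The number `c` is the common weight of the edges of `G` when the weights at each vertex `u`
sum up to `π u`. -/
theorem IsStationary.energy_le [Nontrivial V] (hG : G.Connected) (h : IsStationary G π)
    {c : ℝ} (hc : ∀ u, π u = c * G.degree u) (f : V → ℝ) :
    c / 4 * energy G f ≤ chiSq π f - chiSq π ((lazyMatrix G).mulVec f) := by
  have hd : ∀ u, G.degree u ≠ 0 := fun u =>
    (hG.preconnected.degree_pos_of_nontrivial u).ne'
  refine le_trans (le_of_eq ?_) ((h.isReversible hG).sum_sq_sub_le h.1.1 (fun u => ?_) f)
  · simp only [energy, Finset.mul_sum]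
    refine Finset.sum_congr rfl fun u _ => Finset.sum_congr rfl fun v _ => ?_
    by_cases hadj : G.Adj u v
    · have hdu : (G.degree u : ℝ) ≠ 0 := by exact_mod_cast hd u
      simp only [lazyMatrix, Matrix.of_apply, hadj.ne, hadj, if_true, if_false, hc]
      field_simp
      ring
    · rcases eq_or_ne u v with rfl | huv
      · simp
      · simp [lazyMatrix, hadj, huv]
  · simp [lazyMatrix, hd u]

/-- One step of the lazy walk takes away at least `π_* M² / (80 k)` from the squared distance to
equilibrium, where `1 + M` is the maximum of the density and `k` is the number of vertices at which
it exceeds `1 + M / 2`. -/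
theorem IsStationary.minMass_mul_sq_le [Nontrivial V] (hG : G.Connected) (h : IsStationary G π)
    {f : V → ℝ} (hf : IsDensity π f) {u : V} {M : ℝ} (hM0 : 0 < M) (hM : f u = 1 + M) :
    minMass π * M ^ 2 ≤ 80 * (Finset.univ.filter fun x => 1 + M / 2 < f x).card
      * (chiSq π f - chiSq π ((lazyMatrix G).mulVec f)) := by
  obtain ⟨c, hc0, hc⟩ := h.exists_eq_mul_degree hG
  obtain ⟨w, hw⟩ := exists_eq_ciInf_of_finite (f := π)
  have hδ : ∀ x, G.degree w ≤ G.degree x := fun x => by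
    have h1 : π w ≤ π x := hw.le.trans (minMass_le π x)
    rw [hc, hc] at h1
    exact_mod_cast le_of_mul_le_mul_left h1 hc0
  have hx : ∃ x, f x ≤ f u - M / 2 := by
    by_contra! hcon
    have : ∑ x, π x < ∑ x, f x * π x := Finset.sum_lt_sum_of_nonempty ⟨u, Finset.mem_univ u⟩
      fun x _ => by nlinarith [h.pos hG x, hcon x]
    rw [hf.sum_mul_eq_one, h.1.2] at this
    exact lt_irrefl _ this
  have h1 := degree_mul_sq_le_energy hG f u (half_pos hM0) hδ hx
  rw [hM, show 1 + M - M / 2 = 1 + M / 2 by ring] at h1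
  have h2 := h.energy_le hG hc f
  have hmin : minMass π = c * G.degree w := by rw [← hc]; exact hw.symm
  set k := ((Finset.univ.filter fun x => 1 + M / 2 < f x).card : ℝ)
  have hk : 0 ≤ k := Nat.cast_nonneg _
  calc minMass π * M ^ 2 = 4 * c * (G.degree w * (M / 2) ^ 2) := by rw [hmin]; ring
    _ ≤ 4 * c * (5 * k * energy G f) := by gcongr
    _ = 80 * k * (c / 4 * energy G f) := by ring
    _ ≤ _ := by gcongr

theorem IsStationary.isContracting (hG : G.Connected) (h : IsStationary G π) :
    IsContracting π (lazyMatrix G) := by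
  have hrev := h.isReversible hG
  have := hG.nonempty
  obtain ⟨w, hw⟩ := exists_eq_ciInf_of_finite (f := π)
  have hmin : 0 < minMass π := (h.pos hG w).trans_eq hw
  suffices H : ∀ f, IsDensity π f → 0 ≤ chiSq π f - chiSq π ((lazyMatrix G).mulVec f) ∧
      (chiSq π f ≠ 0 → ∃ M k : ℝ, chiSq π f ≤ M ∧ k ≤ Fintype.card V ∧ k * minMass π * M ≤ 2 ∧
      minMass π * M ^ 2 ≤ 80 * k * (chiSq π f - chiSq π ((lazyMatrix G).mulVec f))) by
    refine ⟨hrev, fun f hf => ?_, fun f hf => ?_⟩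
    all_goals
      obtain ⟨h0, h1⟩ := H f hf
      rcases eq_or_ne (chiSq π f) 0 with hy | hy
    · rw [hy] at h0 ⊢
      have : (0 : ℝ) ≤ 80 * Fintype.card V := by positivity
      simpa using mul_nonneg this h0
    · obtain ⟨M, k, hM, hk, -, hMk⟩ := h1 hy
      have hy0 := chiSq_nonneg h.1.1 f
      calc minMass π * chiSq π f ^ 2 ≤ minMass π * M ^ 2 := by gcongr
        _ ≤ _ := hMk
        _ ≤ _ := by gcongr
    · rw [hy] at h0 ⊢
      linarith
    · obtain ⟨M, k, hM, -, hk, hMk⟩ := h1 hy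
      have hy0 := chiSq_nonneg h.1.1 f
      have hM0 : 0 ≤ M := hy0.trans hM
      calc minMass π ^ 2 * chiSq π f ^ 3 ≤ minMass π ^ 2 * M ^ 3 := by gcongr
        _ = minMass π * M ^ 2 * (minMass π * M) := by ring
        _ ≤ 80 * k * (chiSq π f - chiSq π ((lazyMatrix G).mulVec f)) * (minMass π * M) := by
            gcongr
        _ = 80 * (k * minMass π * M) * (chiSq π f - chiSq π ((lazyMatrix G).mulVec f)) := by ring
        _ ≤ 80 * 2 * (chiSq π f - chiSq π ((lazyMatrix G).mulVec f)) := by gcongr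
        _ = _ := by ring
  intro f hf
  obtain ⟨u, hu⟩ := exists_eq_ciSup_of_finite (f := f)
  have hmax : ∀ x, f x ≤ 1 + (f u - 1) := fun x => by
    rw [hu, add_sub_cancel]; exact le_ciSup (Set.finite_range f).bddAbove x
  have hyM := hf.chiSq_le h.1.1 h.1.2 hmax
  have hy0 := chiSq_nonneg h.1.1 f
  rcases subsingleton_or_nontrivial V with hV | hV
  · have hone : ∀ g, IsDensity π g → chiSq π g = 0 := fun g hg => by
      refine le_antisymm (hg.chiSq_le h.1.1 h.1.2 fun x => ?_) (chiSq_nonneg h.1.1 g)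
      have hs := hg.sum_mul_eq_one
      have hs' := h.1.2
      rw [Fintype.sum_eq_single x fun y hy => (hy (Subsingleton.elim y x)).elim] at hs hs'
      rw [hs', mul_one] at hs
      linarith
    rw [hone f hf, hone _ (hf.mulVec hrev)]
    simp
  · constructor
    · obtain ⟨c, hc0, hc⟩ := h.exists_eq_mul_degree hG
      refine le_trans ?_ (h.energy_le hG hc f)
      have : 0 ≤ energy G f := by simpa using sum_le_energy G f ∅ (by simp)
      positivity
    · intro hy
      have hM0 : 0 < f u - 1 := (hy0.lt_of_ne hy.symm).trans_le hyM
      refine ⟨f u - 1, _, hyM, ?_, ?_,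
        h.minMass_mul_sq_le hG hf (u := u) hM0 (by ring)⟩
      · exact_mod_cast Finset.card_le_univ _
      · set S := Finset.univ.filter fun x => 1 + (f u - 1) / 2 < f x
        have h1 : (S.card : ℝ) * (minMass π * ((f u - 1) / 2)) ≤ ∑ x ∈ S, f x * π x := by
          rw [← nsmul_eq_mul]
          refine Finset.card_nsmul_le_sum _ _ _ fun x hx => ?_
          have hx := (Finset.mem_filter.1 hx).2
          rw [mul_comm]
          exact mul_le_mul (by linarith) (minMass_le π x) hmin.le (hf.nonneg x)
        have h2 : ∑ x ∈ S, f x * π x ≤ 1 := by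
          rw [← hf.sum_mul_eq_one]
          exact Finset.sum_le_sum_of_subset_of_nonneg (Finset.subset_univ S)
            fun x _ _ => mul_nonneg (hf.nonneg x) (h.1.1 x)
        nlinarith

end Step

/-! ### Decay of densities and of transition probabilities -/

section Decay

variable {V : Type*} [Fintype V]

theorem minMass_pos [Nonempty V] {π : V → ℝ} (hπ : ∀ u, 0 < π u) : 0 < minMass π := by
  obtain ⟨w, hw⟩ := exists_eq_ciInf_of_finite (f := π)
  exact (hπ w).trans_eq hw

theorem decay_of_quadratic {a K t y y' : ℝ} (ha : 0 ≤ a) (hK : 0 < K) (hy' : 0 ≤ y')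
    (hstep : a * y ^ 2 ≤ K * (y - y')) (hty : t * (a * y) ≤ K) (hy : 0 ≤ y) (ht : 0 ≤ t) :
    (t + 1) * (a * y') ≤ K := by
  have h1 : K * (a * y') ≤ (a * y) * (K - a * y) := by nlinarith
  have h2 : 0 ≤ (a * y) * (K - a * y) := le_trans (by positivity) h1
  have hay : 0 ≤ a * y := by positivity
  have h3 : (t + 1) * ((a * y) * (K - a * y)) ≤ K * K := by
    rcases hay.eq_or_lt with h0 | h0
    · rw [← h0]; nlinarith
    · have h4 : 0 ≤ K - a * y := nonneg_of_mul_nonneg_right h2 h0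
      nlinarith
  refine le_of_mul_le_mul_left (le_trans ?_ h3) hK
  nlinarith

theorem decay_of_cubic {a t y y' : ℝ} (hy' : 0 ≤ y')
    (hstep : a ^ 2 * y ^ 3 ≤ 160 * (y - y')) (hty : t * (a * y) ^ 2 ≤ 80) (hy : 0 ≤ y)
    (ht : 0 ≤ t) : (t + 1) * (a * y') ^ 2 ≤ 80 := by
  obtain ⟨w, hw⟩ : ∃ w, w = (a * y) ^ 2 / 80 := ⟨_, rfl⟩
  have hw0 : 0 ≤ w := by rw [hw]; positivity
  have htw : t * w ≤ 1 := by rw [hw]; linarith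
  have h1 : 2 * y' ≤ y * (2 - w) := by rw [hw]; linarith
  have h2 : (t + 1) * (w * (2 - w) ^ 2) ≤ 4 := by
    rcases hy.eq_or_lt with h0 | h0
    · rw [hw, ← h0]; norm_num
    · have h3 : 0 ≤ 2 - w := nonneg_of_mul_nonneg_right ((by positivity : 0 ≤ 2 * y').trans h1) h0
      calc (t + 1) * (w * (2 - w) ^ 2) = (t * w + w) * (2 - w) ^ 2 := by ring
        _ ≤ (1 + w) * (2 - w) ^ 2 := by gcongr
        _ = 4 - w ^ 2 * (1 + (2 - w)) := by ring
        _ ≤ 4 := by nlinarith [mul_nonneg (sq_nonneg w) (by linarith : 0 ≤ 1 + (2 - w))]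
  have h4 : (2 * y') ^ 2 ≤ (y * (2 - w)) ^ 2 := pow_le_pow_left₀ (by positivity) h1 2
  calc (t + 1) * (a * y') ^ 2 = (t + 1) * (a ^ 2 * (2 * y') ^ 2) / 4 := by ring
    _ ≤ (t + 1) * (a ^ 2 * (y * (2 - w)) ^ 2) / 4 := by gcongr
    _ = 20 * ((t + 1) * ((a * y) ^ 2 / 80 * (2 - w) ^ 2)) := by ring
    _ ≤ 80 := by rw [← hw]; linarith

/-- Decay of the distance to equilibrium of a density that evolves under contracting steps. -/
theorem chiSq_decay [Nonempty V] {π : V → ℝ} (hπ : ∀ u, 0 < π u) {f : ℕ → V → ℝ} {T : ℕ}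
    (h0 : IsDensity π (f 0))
    (hf : ∀ i < T, ∃ Q, IsContracting π Q ∧ f (i + 1) = Q.mulVec (f i)) :
    T * (minMass π * chiSq π (f T)) ≤ 80 * Fintype.card V ∧
      T * (minMass π * chiSq π (f T)) ^ 2 ≤ 80 := by
  have hmin : 0 ≤ minMass π := Real.iInf_nonneg fun u => (hπ u).le
  have hn : (0 : ℝ) < Fintype.card V := by exact_mod_cast Fintype.card_pos
  suffices H : ∀ t ≤ T, IsDensity π (f t) ∧
      t * (minMass π * chiSq π (f t)) ≤ 80 * Fintype.card V ∧
      t * (minMass π * chiSq π (f t)) ^ 2 ≤ 80 from (H T le_rfl).2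
  intro t
  induction t with
  | zero => exact fun _ => ⟨h0, by simp, by simp⟩
  | succ t ih =>
    intro ht
    obtain ⟨hd, h1, h2⟩ := ih (by omega)
    obtain ⟨Q, hQ, hfQ⟩ := hf t (by omega)
    have hy := chiSq_nonneg (fun u => (hπ u).le) (f t)
    have hy' := chiSq_nonneg (fun u => (hπ u).le) (f (t + 1))
    rw [hfQ] at hy' ⊢
    push_cast
    exact ⟨hd.mulVec hQ.toIsReversible,
      decay_of_quadratic hmin (by positivity) hy' (hQ.quadratic _ hd) h1 hy t.cast_nonneg,
      decay_of_cubic hy' (hQ.cubic _ hd) h2 hy t.cast_nonneg⟩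

variable [DecidableEq V]

/-- The transition matrix `P 0 * P 1 * ⋯ * P (t - 1)` of the first `t` steps of an inhomogeneous
chain. -/
def stepProd (P : ℕ → Matrix V V ℝ) : ℕ → Matrix V V ℝ
  | 0 => 1
  | t + 1 => stepProd P t * P t

theorem stepProd_add (P : ℕ → Matrix V V ℝ) (s t : ℕ) :
    stepProd P (s + t) = stepProd P s * stepProd (fun i => P (s + i)) t := by
  induction t with
  | zero => simp [stepProd]
  | succ t ih => rw [← add_assoc, stepProd, ih, stepProd, Matrix.mul_assoc]

theorem stepProd_succ' (P : ℕ → Matrix V V ℝ) (t : ℕ) :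
    stepProd P (t + 1) = P 0 * stepProd (fun i => P (i + 1)) t := by
  rw [add_comm, stepProd_add]
  simp [stepProd, add_comm]

variable {π : V → ℝ} {P : ℕ → Matrix V V ℝ}

theorem stepProd_nonneg (hP : ∀ t, IsReversible π (P t)) (t : ℕ) (u v : V) :
    0 ≤ stepProd P t u v := by
  induction t generalizing v with
  | zero => rw [stepProd, Matrix.one_apply]; split_ifs <;> norm_num
  | succ t ih =>
    rw [stepProd, Matrix.mul_apply]
    exact Finset.sum_nonneg fun w _ => mul_nonneg (ih w) ((hP t).nonneg w v)

theorem stepProd_row_sum (hP : ∀ t, IsReversible π (P t)) (t : ℕ) (u : V) :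
    ∑ v, stepProd P t u v = 1 := by
  induction t with
  | zero => simp [stepProd, Matrix.one_apply]
  | succ t ih =>
    simp only [stepProd, Matrix.mul_apply]
    rw [Finset.sum_comm]
    simp [← Finset.mul_sum, (hP t).row_sum, ih]

theorem stepProd_le_one (hP : ∀ t, IsReversible π (P t)) (t : ℕ) (u v : V) :
    stepProd P t u v ≤ 1 := by
  rw [← stepProd_row_sum hP t u]
  exact Finset.single_le_sum (f := stepProd P t u) (fun w _ => stepProd_nonneg hP t u w)
    (Finset.mem_univ v)

theorem isDensity_single (hπ : ∀ u, 0 < π u) (v : V) :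
    IsDensity π fun w => (1 : Matrix V V ℝ) w v / π v where
  nonneg w := div_nonneg (by rw [Matrix.one_apply]; split_ifs <;> norm_num) (hπ v).le
  sum_mul_eq_one := by
    rw [Finset.sum_eq_single v (fun w _ hw => by simp [hw]) (by simp)]
    simp [(hπ v).ne']

/-- By reversibility the density of the chain at time `t` evolves by applying `P t` to it as a
function. -/
theorem rowDensity_succ (hπ : ∀ u, 0 < π u) (hP : ∀ t, IsReversible π (P t)) (u : V) (t : ℕ) :
    (fun v => stepProd P (t + 1) u v / π v)
      = (P t).mulVec fun v => stepProd P t u v / π v := by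
  ext w
  simp only [stepProd, Matrix.mul_apply, Matrix.mulVec, dotProduct, Finset.sum_div]
  refine Finset.sum_congr rfl fun v _ => ?_
  have := (hπ v).ne'
  have := (hπ w).ne'
  have := (hP t).detailed_balance v w
  field_simp
  linear_combination (stepProd P t u v) * this

theorem rowDensity_decay [Nonempty V] (hπ : ∀ u, 0 < π u) (hP : ∀ t, IsContracting π (P t))
    (u : V) (t : ℕ) :
    t * (minMass π * chiSq π fun v => stepProd P t u v / π v) ≤ 80 * Fintype.card V ∧
      t * (minMass π * chiSq π fun v => stepProd P t u v / π v) ^ 2 ≤ 80 := by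
  refine chiSq_decay hπ (f := fun t v => stepProd P t u v / π v) ?_ fun i _ =>
    ⟨P i, hP i, rowDensity_succ hπ (fun t => (hP t).toIsReversible) u i⟩
  convert isDensity_single hπ u using 2 with v
  rcases eq_or_ne u v with rfl | huv
  · rfl
  · simp [stepProd, huv, huv.symm]

/-- As a function of the starting vertex, the density of the chain at `v` evolves from the last
step to the first by the same kind of steps. -/
theorem colDensity_decay [Nonempty V] (hπ : ∀ u, 0 < π u) (hP : ∀ t, IsContracting π (P t))
    (v : V) (t : ℕ) :
    t * (minMass π * chiSq π fun u => stepProd P t u v / π v) ≤ 80 * Fintype.card V ∧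
      t * (minMass π * chiSq π fun u => stepProd P t u v / π v) ^ 2 ≤ 80 := by
  have h := chiSq_decay hπ (T := t)
    (f := fun i u => stepProd (fun j => P (t - i + j)) i u v / π v) ?_ fun i hi =>
      ⟨P (t - (i + 1)), hP _, ?_⟩
  · simpa using h
  · exact isDensity_single hπ v
  · ext u
    have : ∀ j, t - (i + 1) + (j + 1) = t - i + j := fun j => by omega
    simp only [stepProd_succ', Matrix.mul_apply, Matrix.mulVec, dotProduct, Finset.sum_div, this,
      add_zero, mul_div_assoc]

/-- Two halves of the walk meet in the middle: the deviation from equilibrium of a transition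
probability is an inner product in `ℓ₂(π)`, to which Cauchy-Schwarz applies. -/
theorem abs_stepProd_div_sub_one_le (hπ : ∀ u, 0 < π u) (hsum : ∑ u, π u = 1)
    (hP : ∀ t, IsReversible π (P t)) (u v : V) (s t : ℕ) {X : ℝ} (hX : 0 ≤ X)
    (hs : chiSq π (fun w => stepProd P s u w / π w) ≤ X)
    (ht : chiSq π (fun w => stepProd (fun i => P (s + i)) t w v / π v) ≤ X) :
    |stepProd P (s + t) u v / π v - 1| ≤ X := by
  set Q := stepProd (fun i => P (s + i)) t with hQ
  have hcol : ∑ w, Q w v * π w = π v := by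
    have : ∀ t, ∀ v, ∑ w, stepProd (fun i => P (s + i)) t w v * π w = π v := by
      intro t
      induction t with
      | zero => intro v; simp [stepProd, Matrix.one_apply]
      | succ t ih =>
        intro v
        simp only [stepProd, Matrix.mul_apply, Finset.sum_mul]
        rw [Finset.sum_comm]
        calc _ = ∑ x, (∑ w, stepProd (fun i => P (s + i)) t w x * π w) * P (s + t) x v := by
              simp_rw [Finset.sum_mul]
              exact Finset.sum_congr rfl fun _ _ => Finset.sum_congr rfl fun _ _ => by ring
          _ = ∑ x, π v * P (s + t) v x := Finset.sum_congr rfl fun x _ => by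
              rw [ih, (hP (s + t)).detailed_balance]
          _ = π v := by rw [← Finset.mul_sum, (hP _).row_sum, mul_one]
    exact this t v
  have hv := (hπ v).ne'
  have hkey : stepProd P (s + t) u v / π v - 1
      = ∑ w, (stepProd P s u w / π w - 1) * (Q w v / π v - 1) * π w := by
    have hw : ∀ w, (stepProd P s u w / π w - 1) * (Q w v / π v - 1) * π w
        = stepProd P s u w * Q w v / π v - stepProd P s u w - Q w v * π w / π v + π w := by
      intro w
      have := (hπ w).ne'
      field_simp
      ring
    simp_rw [hw]
    rw [Finset.sum_add_distrib, Finset.sum_sub_distrib, Finset.sum_sub_distrib, hsum,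
      stepProd_row_sum hP, ← Finset.sum_div, ← Finset.sum_div, hcol, div_self hv, stepProd_add,
      Matrix.mul_apply]
    ring
  rw [hkey]
  refine abs_le_of_sq_le_sq ?_ hX
  calc _ ≤ chiSq π (fun w => stepProd P s u w / π w) * chiSq π (fun w => Q w v / π v) :=
        Finset.sum_sq_le_sum_mul_sum_of_sq_le_mul _
          (fun w _ => mul_nonneg (sq_nonneg _) (hπ w).le)
          (fun w _ => mul_nonneg (sq_nonneg _) (hπ w).le) (fun w _ => le_of_eq (by ring))
    _ ≤ X * X := mul_le_mul hs ht (chiSq_nonneg (fun w => (hπ w).le) _) hX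
    _ = X ^ 2 := by ring

/-- Pointwise convergence to equilibrium at the rates `n / (π_* t)` and `1 / (π_* √t)`. -/
theorem abs_stepProd_div_sub_one_decay [Nonempty V] (hπ : ∀ u, 0 < π u) (hsum : ∑ u, π u = 1)
    (hP : ∀ t, IsContracting π (P t)) {t : ℕ} (ht : 1 ≤ t) (u v : V) :
    |stepProd P t u v / π v - 1| ≤ 240 * Fintype.card V / (minMass π * t) ∧
      |stepProd P t u v / π v - 1| ≤ 16 / (minMass π * √t) := by
  have hm := minMass_pos hπ
  have hP' := fun t => (hP t).toIsReversible
  have hn : (1 : ℝ) ≤ Fintype.card V := by exact_mod_cast Fintype.card_pos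
  have ht0 : (0 : ℝ) < t := by exact_mod_cast ht
  rcases ht.eq_or_lt with rfl | ht2
  · have h1 : |stepProd P 1 u v / π v - 1| ≤ 1 / minMass π := by
      have h2 : stepProd P 1 u v / π v ≤ 1 / minMass π :=
        div_le_div₀ zero_le_one (stepProd_le_one hP' 1 u v) hm (minMass_le π v)
      have h3 : 0 ≤ stepProd P 1 u v / π v := div_nonneg (stepProd_nonneg hP' 1 u v) (hπ v).le
      have h4 : 1 ≤ 1 / minMass π := by
        rw [le_div_iff₀ hm, one_mul, ← hsum]
        exact (minMass_le π v).trans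
          (Finset.single_le_sum (fun w _ => (hπ w).le) (Finset.mem_univ v))
      rw [abs_le]
      constructor <;> linarith
    refine ⟨h1.trans ?_, h1.trans ?_⟩
    · rw [Nat.cast_one, mul_one]
      gcongr
      linarith
    · rw [Nat.cast_one, Real.sqrt_one, mul_one]
      gcongr
      norm_num
  · -- Both halves last at least a third of the whole time.
    obtain ⟨s, r, hs, hr, rfl⟩ : ∃ s r, t ≤ 3 * s ∧ t ≤ 3 * r ∧ t = s + r :=
      ⟨t / 2, t - t / 2, by omega, by omega, by omega⟩
    have hhalf : ∀ (q : ℕ) (y : ℝ), s + r ≤ 3 * q → 0 ≤ y →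
        q * (minMass π * y) ≤ 80 * Fintype.card V ∧ q * (minMass π * y) ^ 2 ≤ 80 →
        y ≤ 240 * Fintype.card V / (minMass π * (s + r : ℕ)) ∧
          y ≤ 16 / (minMass π * √(s + r : ℕ)) := by
      intro q y hq hy ⟨h1, h2⟩
      have hq' : ((s + r : ℕ) : ℝ) ≤ 3 * q := by exact_mod_cast hq
      constructor
      · rw [le_div_iff₀ (by positivity)]
        have : ((s + r : ℕ) : ℝ) * (minMass π * y) ≤ 3 * q * (minMass π * y) := by gcongr
        linarith
      · rw [le_div_iff₀ (by positivity)]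
        refine le_of_sq_le_sq ?_ (by norm_num)
        have : ((s + r : ℕ) : ℝ) * (minMass π * y) ^ 2 ≤ 3 * q * (minMass π * y) ^ 2 := by gcongr
        rw [← mul_assoc, mul_pow, Real.sq_sqrt ht0.le, mul_comm y]
        linarith
    have hnn := fun f => chiSq_nonneg (fun w => (hπ w).le) f
    have hrow := hhalf s _ hs (hnn _) (rowDensity_decay hπ hP u s)
    have hcol := hhalf r _ hr (hnn _) (colDensity_decay hπ (fun i => hP (s + i)) v r)
    exact ⟨abs_stepProd_div_sub_one_le hπ hsum hP' u v s r (by positivity) hrow.1 hcol.1,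
      abs_stepProd_div_sub_one_le hπ hsum hP' u v s r (by positivity) hrow.2 hcol.2⟩

end Decay

/-! ### Visits and hitting times of inhomogeneous chains -/

section Hitting

variable {V : Type*} [Fintype V] [DecidableEq V]

/-- The probability that the inhomogeneous chain with transition matrices `P`, started at `u` at
time `0`, is not at `v` at any of the times `1, …, t`. The position at time `0` does not count. -/
def avoidProb (v : V) : (ℕ → Matrix V V ℝ) → ℕ → V → ℝ
  | _, 0, _ => 1
  | P, t + 1, u => ∑ w, P 0 u w * if w = v then 0 else avoidProb v (fun i => P (i + 1)) t w

variable {π : V → ℝ} {v : V}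

theorem avoidProb_nonneg {P : ℕ → Matrix V V ℝ} (hP : ∀ t, IsReversible π (P t)) (t : ℕ) (u : V) :
    0 ≤ avoidProb v P t u := by
  induction t generalizing P u with
  | zero => exact zero_le_one
  | succ t ih =>
    refine Finset.sum_nonneg fun w _ => mul_nonneg ((hP 0).nonneg u w) ?_
    split_ifs
    · exact le_rfl
    · exact ih (fun i => hP (i + 1)) w

theorem avoidProb_add_le {P : ℕ → Matrix V V ℝ} (hP : ∀ t, IsReversible π (P t)) (s t : ℕ) {q : ℝ}
    (hq : ∀ w, avoidProb v (fun i => P (s + i)) t w ≤ q) (u : V) :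
    avoidProb v P (s + t) u ≤ q * avoidProb v P s u := by
  induction s generalizing P u with
  | zero => simpa [avoidProb] using hq u
  | succ s ih =>
    rw [add_right_comm, avoidProb, avoidProb, Finset.mul_sum]
    refine Finset.sum_le_sum fun w _ => ?_
    split_ifs
    · simp
    · have h := ih (P := fun i => P (i + 1)) (fun i => hP (i + 1))
        (by simpa only [add_right_comm] using hq) w
      calc _ ≤ P 0 u w * (q * avoidProb v (fun i => P (i + 1)) s w) :=
            mul_le_mul_of_nonneg_left h ((hP 0).nonneg u w)
        _ = _ := by ring

theorem avoidProb_le_one {P : ℕ → Matrix V V ℝ} (hP : ∀ t, IsReversible π (P t)) (t : ℕ) (u : V) :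
    avoidProb v P t u ≤ 1 := by
  induction t generalizing P u with
  | zero => exact le_rfl
  | succ t ih =>
    rw [avoidProb, ← (hP 0).row_sum u]
    refine Finset.sum_le_sum fun w _ => mul_le_of_le_one_right ((hP 0).nonneg u w) ?_
    split_ifs
    · exact zero_le_one
    · exact ih (fun i => hP (i + 1)) w

/-- The expected number of visits to `v` during the times `1, …, s` is at most the probability of
a visit times a bound `B` on the expected number of visits that follow the first one, which is
itself counted. -/
theorem sum_stepProd_le {P : ℕ → Matrix V V ℝ} (hP : ∀ t, IsReversible π (P t)) (s : ℕ) {B : ℝ}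
    (hB : ∀ a, 1 + ∑ t ∈ Finset.range s, stepProd (fun i => P (a + i)) (t + 1) v v ≤ B) (u : V) :
    ∑ t ∈ Finset.range s, stepProd P (t + 1) u v ≤ B * (1 - avoidProb v P s u) := by
  induction s generalizing P u with
  | zero => simp [avoidProb]
  | succ s ih =>
    have hB' : ∀ a, 1 + ∑ t ∈ Finset.range s, stepProd (fun i => P (a + i)) (t + 1) v v ≤ B :=
      fun a => le_trans (by
        rw [Finset.sum_range_succ]
        linarith [stepProd_nonneg (fun i => hP (a + i)) (s + 1) v v]) (hB a)
    have hrec : ∑ t ∈ Finset.range (s + 1), stepProd P (t + 1) u v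
        = ∑ w, P 0 u w * ((if w = v then 1 else 0)
          + ∑ t ∈ Finset.range s, stepProd (fun i => P (i + 1)) (t + 1) w v) := by
      simp_rw [stepProd_succ' P, Matrix.mul_apply]
      rw [Finset.sum_comm]
      refine Finset.sum_congr rfl fun w _ => ?_
      rw [← Finset.mul_sum, Finset.sum_range_succ', add_comm]
      simp only [stepProd, Matrix.one_apply]
    have hsplit : B * (1 - avoidProb v P (s + 1) u) = ∑ w, P 0 u w *
        (B * (1 - if w = v then 0 else avoidProb v (fun i => P (i + 1)) s w)) := by
      conv_lhs => rw [avoidProb, ← (hP 0).row_sum u, ← Finset.sum_sub_distrib, Finset.mul_sum]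
      exact Finset.sum_congr rfl fun w _ => by ring
    rw [hrec, hsplit]
    refine Finset.sum_le_sum fun w _ => mul_le_mul_of_nonneg_left ?_ ((hP 0).nonneg u w)
    by_cases hw : w = v
    · simpa [hw, add_comm] using hB' 1
    · simpa [hw] using ih (P := fun i => P (i + 1)) (fun i => hP (i + 1))
        (fun a => by simpa only [add_assoc, add_comm 1, add_left_comm] using hB' (a + 1)) w

/-- If every window of length `s` contains a visit with probability at least `ε`, the waiting time
for a visit has mean at most `s / ε`. -/
theorem sum_avoidProb_le {P : ℕ → Matrix V V ℝ} (hP : ∀ t, IsReversible π (P t)) {s : ℕ}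
    (hs : 1 ≤ s) {ε : ℝ} (hε : 0 < ε)
    (h : ∀ a u, avoidProb v (fun i => P (a + i)) s u ≤ 1 - ε) (u : V) (N : ℕ) :
    ∑ t ∈ Finset.range N, avoidProb v P t u ≤ s / ε := by
  have hq : 0 ≤ 1 - ε := (avoidProb_nonneg (fun i => hP (0 + i)) s u).trans (h 0 u)
  have hpow : ∀ k, avoidProb v P (s * k) u ≤ (1 - ε) ^ k := fun k => by
    induction k with
    | zero => simp [avoidProb]
    | succ k ih =>
      rw [Nat.mul_succ, pow_succ']
      exact (avoidProb_add_le hP (s * k) s (h (s * k)) u).trans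
        (mul_le_mul_of_nonneg_left ih hq)
  have hblock : ∀ k, ∑ t ∈ Finset.range (s * k), avoidProb v P t u
      ≤ s / ε * (1 - (1 - ε) ^ k) := fun k => by
    induction k with
    | zero => simp
    | succ k ih =>
      have h1 : ∑ x ∈ Finset.range s, avoidProb v P (s * k + x) u ≤ s * (1 - ε) ^ k := by
        calc _ ≤ ∑ x ∈ Finset.range s, (1 - ε) ^ k := Finset.sum_le_sum fun x _ => by
              refine le_trans ?_ (hpow k)
              simpa using avoidProb_add_le hP (s * k) x
                (avoidProb_le_one (fun i => hP (s * k + i)) x) u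
          _ = _ := by simp
      rw [Nat.mul_succ, Finset.sum_range_add]
      calc _ ≤ s / ε * (1 - (1 - ε) ^ k) + s * (1 - ε) ^ k := add_le_add ih h1
        _ = _ := by field_simp; ring
  calc ∑ t ∈ Finset.range N, avoidProb v P t u
      ≤ ∑ t ∈ Finset.range (s * N), avoidProb v P t u :=
        Finset.sum_le_sum_of_subset_of_nonneg
          (Finset.range_subset_range.2 (Nat.le_mul_of_pos_left N hs))
          fun t _ _ => avoidProb_nonneg hP t u
    _ ≤ s / ε * (1 - (1 - ε) ^ N) := hblock N
    _ ≤ s / ε := mul_le_of_le_one_right (by positivity) (by linarith [pow_nonneg hq N])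

/-- A window of length `s` is hit with probability at least `1 / 16` once it is twice as long as
the time after which all transition probabilities into `v` exceed `π v / 2`, and the deviations of
the return probabilities to `v` from equilibrium do not accumulate faster than equilibrium visits.
Indeed the expected number of visits is then at least `π v * s / 4`, and from the first visit on it
is at most `4 * (π v * s)`. -/
theorem sum_avoidProb_le_of_decay {P : ℕ → Matrix V V ℝ} (hP : ∀ t, IsReversible π (P t))
    (hπ : 0 < π v) {s r : ℕ} {d : ℕ → ℝ} (hs : 1 ≤ π v * s) (hr : 2 * r ≤ s)
    (hd : ∀ a t, |stepProd (fun i => P (a + i)) (t + 1) v v / π v - 1| ≤ d t)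
    (hdsum : ∑ t ∈ Finset.range s, d t ≤ 2 * s)
    (hhalf : ∀ a t u, r ≤ t → |stepProd (fun i => P (a + i)) (t + 1) u v / π v - 1| ≤ 1 / 2)
    (u : V) (N : ℕ) : ∑ t ∈ Finset.range N, avoidProb v P t u ≤ 16 * s := by
  have hs1 : 1 ≤ s := Nat.one_le_iff_ne_zero.2 fun h0 => by
    rw [h0] at hs; norm_num at hs
  have hwin : ∀ a u, avoidProb v (fun i => P (a + i)) s u ≤ 1 - 1 / 16 := by
    intro a u
    have hup := sum_stepProd_le (v := v) (B := 4 * (π v * s)) (fun i => hP (a + i)) s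
      (fun b => ?_) u
    · have hlow : π v * s / 4
          ≤ ∑ t ∈ Finset.range s, stepProd (fun i => P (a + i)) (t + 1) u v := by
        have hr' : (2 : ℝ) * r ≤ s := by exact_mod_cast hr
        calc π v * s / 4 ≤ (s - r) * (π v / 2) := by nlinarith
          _ = ∑ t ∈ Finset.Ico r s, π v / 2 := by
              rw [Finset.sum_const, Nat.card_Ico, nsmul_eq_mul, Nat.cast_sub (by omega)]
          _ ≤ ∑ t ∈ Finset.Ico r s, stepProd (fun i => P (a + i)) (t + 1) u v := by
              refine Finset.sum_le_sum fun t ht => ?_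
              have h1 := (abs_le.1 (hhalf a t u (Finset.mem_Ico.1 ht).1)).1
              have h2 : 1 / 2 ≤ stepProd (fun i => P (a + i)) (t + 1) u v / π v := by linarith
              rw [le_div_iff₀ hπ] at h2
              linarith
          _ ≤ _ := Finset.sum_le_sum_of_subset_of_nonneg
              (fun t ht => Finset.mem_range.2 (Finset.mem_Ico.1 ht).2)
              fun t _ _ => stepProd_nonneg (fun i => hP (a + i)) _ _ _
      nlinarith
    · have hterm : ∀ t ∈ Finset.range s, stepProd (fun i => P (a + (b + i))) (t + 1) v v
          ≤ π v * (1 + d t) := fun t _ => by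
        have h1 := (abs_le.1 (hd (a + b) t)).2
        simp only [add_assoc] at h1
        have h2 : stepProd (fun i => P (a + (b + i))) (t + 1) v v / π v ≤ 1 + d t := by linarith
        rw [div_le_iff₀ hπ] at h2
        linarith
      have h3 := Finset.sum_le_sum hterm
      rw [← Finset.mul_sum, Finset.sum_add_distrib] at h3
      simp only [Finset.sum_const, Finset.card_range, nsmul_eq_mul, mul_one] at h3
      nlinarith
  refine (sum_avoidProb_le hP hs1 (by norm_num) hwin u N).trans_eq ?_
  ring

end Hitting

/-! ### The law of the trajectory -/

section Trajectory

variable {V : Type*}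

/-- The trajectories that do not visit `v` at the times `a + 1, …, a + t`. -/
def avoidSet (v : V) (a t : ℕ) : Set (ℕ → V) := {ω | ∀ i, a < i → i ≤ a + t → ω i ≠ v}

theorem measurableSet_avoidSet [MeasurableSpace V] [DiscreteMeasurableSpace V] (v : V) (a t : ℕ) :
    MeasurableSet (avoidSet v a t) := by
  have : avoidSet v a t = ⋂ (i : ℕ) (_ : a < i) (_ : i ≤ a + t), (fun ω => ω i) ⁻¹' {v}ᶜ := by
    ext ω; simp [avoidSet]
  rw [this]
  exact MeasurableSet.iInter fun i => MeasurableSet.iInter fun _ => MeasurableSet.iInter fun _ =>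
    measurable_pi_apply i (MeasurableSet.of_discrete)

theorem firstHit_le_tsum (v : V) (ω : ℕ → V) :
    firstHit v ω ≤ ∑' t, (avoidSet v 0 t).indicator 1 ω := by
  have hN : ∀ N : ℕ, (∀ i < N, ω i ≠ v) →
      (N : ℝ≥0∞) ≤ ∑' t, (avoidSet v 0 t).indicator 1 ω := fun N h => by
    refine le_trans (le_of_eq ?_) (ENNReal.sum_le_tsum (Finset.range N))
    rw [Finset.sum_congr rfl fun t ht => Set.indicator_of_mem (f := 1) (a := ω) (s := avoidSet v 0 t)
      fun i _ hi => h i (by have := Finset.mem_range.1 ht; omega)]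
    simp
  by_cases hex : ∃ t, ω t = v
  · classical
    exact (iInf₂_le (Nat.find hex) (Nat.find_spec hex)).trans
      (hN _ fun i hi => Nat.find_min hex hi)
  · push Not at hex
    rw [ENNReal.eq_top_of_forall_nnreal_le (x := ∑' t, (avoidSet v 0 t).indicator 1 ω) fun r => ?_]
    · exact le_top
    · obtain ⟨N, hx⟩ := exists_nat_ge r
      exact le_trans (by exact_mod_cast hx) (hN N fun i _ => hex i)

variable [Fintype V] [DecidableEq V] [MeasurableSpace V] [DiscreteMeasurableSpace V]
  (G : ℕ → SimpleGraph V) [∀ t, DecidableRel (G t).Adj] {π : V → ℝ}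

theorem traj_avoidSet_le (hG : ∀ t, (G t).Connected) (hπ : ∀ t, IsStationary (G t) π) (v : V)
    (t a : ℕ) (h : (_ : Finset.Iic a) → V) :
    Kernel.traj (X := fun _ => V) (stepKernel G) a h (avoidSet v a t)
      ≤ ENNReal.ofReal (avoidProb v (fun i => lazyMatrix (G (a + i))) t
          (h ⟨a, Finset.mem_Iic.2 le_rfl⟩)) := by
  induction t generalizing a with
  | zero => simpa [avoidProb] using prob_le_one
  | succ t ih =>
    have hP : ∀ a i, IsReversible π (lazyMatrix (G (a + i))) := fun a i =>
      (hπ _).isReversible (hG _)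
    -- The bound for the walk from time `a + 1` on, in terms of its position at that time.
    let F : V → ℝ≥0∞ := fun w => ENNReal.ofReal
      (if w = v then 0 else avoidProb v (fun i => lazyMatrix (G (a + 1 + i))) t w)
    have hF : ∀ h' : (_ : Finset.Iic (a + 1)) → V,
        Kernel.traj (X := fun _ => V) (stepKernel G) (a + 1) h' (avoidSet v a (t + 1))
          ≤ F (h' ⟨a + 1, Finset.mem_Iic.2 le_rfl⟩) := by
      intro h'
      by_cases hv : h' ⟨a + 1, Finset.mem_Iic.2 le_rfl⟩ = v
      · rw [← Kernel.traj_map_updateFinset, Measure.map_apply measurable_updateFinset_left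
          (measurableSet_avoidSet v a (t + 1))]
        refine (measure_mono_null (t := ∅) (fun ω hω => ?_) measure_empty).trans_le zero_le
        refine hω (a + 1) (by omega) (by omega) ?_
        simpa [Function.updateFinset] using hv
      · simp only [F, hv, if_false]
        have hsub : avoidSet v a (t + 1) ⊆ avoidSet v (a + 1) t := fun ω hω i hi hi' =>
          hω i (by omega) (by omega)
        exact (measure_mono hsub).trans (ih (a + 1) h')
    rw [← Kernel.traj_comp_partialTraj (Nat.le_succ a),
      Kernel.comp_apply' _ _ _ (measurableSet_avoidSet v a (t + 1))]
    calc _ ≤ ∫⁻ h', F (h' ⟨a + 1, Finset.mem_Iic.2 le_rfl⟩)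
            ∂(Kernel.partialTraj (X := fun _ => V) (stepKernel G) a (a + 1) h) :=
          lintegral_mono hF
      _ = ∫⁻ w, F w ∂(stepKernel G a h) := by
          conv_rhs => rw [← Kernel.map_partialTraj_succ_self (X := fun _ => V)
            (κ := stepKernel G) a]
          rw [Kernel.map_apply _ (by fun_prop), lintegral_map (measurable_of_finite F) (by fun_prop)]
      _ = ∑ w, F w * ENNReal.ofReal (lazyMatrix (G a) (h ⟨a, Finset.mem_Iic.2 le_rfl⟩) w) := by
          rw [lintegral_fintype]
          refine Finset.sum_congr rfl fun w _ => ?_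
          congr 1
          exact (PMF.toMeasure_apply_singleton _ _ (MeasurableSet.singleton w))
      _ = _ := by
          rw [avoidProb, ENNReal.ofReal_sum_of_nonneg]
          · refine Finset.sum_congr rfl fun w _ => ?_
            have hshift : (fun i => lazyMatrix (G (a + 1 + i)))
                = fun i => lazyMatrix (G (a + (i + 1))) :=
              funext fun i => congrArg (fun j => lazyMatrix (G j)) (by omega)
            rw [ENNReal.ofReal_mul ((hP a 0).nonneg _ _), mul_comm, add_zero, ← hshift]
          · intro w _
            refine mul_nonneg ((hP a 0).nonneg _ _) ?_
            split_ifs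
            · exact le_rfl
            · exact avoidProb_nonneg (fun i => hP a (i + 1)) t w

theorem hittingTime_le (hG : ∀ t, (G t).Connected) (hπ : ∀ t, IsStationary (G t) π) (u v : V)
    {B : ℝ} (hB : ∀ N, ∑ t ∈ Finset.range N, avoidProb v (fun i => lazyMatrix (G i)) t u ≤ B) :
    hittingTime G u v ≤ ENNReal.ofReal B := by
  calc hittingTime G u v ≤ ∫⁻ ω, ∑' t, (avoidSet v 0 t).indicator 1 ω ∂(walkLaw G u) :=
        lintegral_mono (firstHit_le_tsum v)
    _ = ∑' t, walkLaw G u (avoidSet v 0 t) := by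
        rw [lintegral_tsum fun t =>
          (measurable_one.indicator (measurableSet_avoidSet v 0 t)).aemeasurable]
        simp_rw [lintegral_indicator_one (measurableSet_avoidSet v 0 _)]
    _ ≤ ∑' t, ENNReal.ofReal (avoidProb v (fun i => lazyMatrix (G i)) t u) :=
        ENNReal.tsum_le_tsum fun t => by
          have hshift : (fun i => lazyMatrix (G (0 + i))) = fun i => lazyMatrix (G i) :=
            funext fun i => congrArg (fun j => lazyMatrix (G j)) (zero_add i)
          rw [← hshift]
          exact traj_avoidSet_le G hG hπ v t 0 fun _ => u
    _ ≤ ENNReal.ofReal B := by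
        refine ENNReal.tsum_le_of_sum_range_le fun N => ?_
        rw [← ENNReal.ofReal_sum_of_nonneg fun t _ =>
          avoidProb_nonneg (fun i => (hπ i).isReversible (hG i)) t u]
        exact ENNReal.ofReal_le_ofReal (hB N)

end Trajectory

/-! ### Mixing and hitting times of the lazy walk -/

section Bounds

variable {V : Type*} [Fintype V] [DecidableEq V]

theorem IsStationary.one_le_minMass_mul_sq [Nontrivial V] {G : SimpleGraph V} [DecidableRel G.Adj]
    {π : V → ℝ} (hG : G.Connected) (h : IsStationary G π) :
    1 ≤ minMass π * (Fintype.card V : ℝ) ^ 2 := by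
  obtain ⟨c, hc0, hc⟩ := h.exists_eq_mul_degree hG
  obtain ⟨w, hw⟩ := exists_eq_ciInf_of_finite (f := π)
  have hcw : c ≤ minMass π := by
    rw [minMass, ← hw, hc]
    exact le_mul_of_one_le_right hc0.le
      (by exact_mod_cast hG.preconnected.degree_pos_of_nontrivial w)
  calc (1 : ℝ) = ∑ u, c * G.degree u := by rw [← h.1.2]; exact Finset.sum_congr rfl fun u _ => hc u
    _ ≤ ∑ u : V, c * Fintype.card V := by
        gcongr with u
        exact_mod_cast (G.degree_lt_card_verts u).le
    _ = c * (Fintype.card V : ℝ) ^ 2 := by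
        rw [Finset.sum_const, Finset.card_univ, nsmul_eq_mul]; ring
    _ ≤ _ := by gcongr

theorem IsStationary.minMass_eq_of_isRegular {G : SimpleGraph V} [DecidableRel G.Adj] {π : V → ℝ}
    (hG : G.Connected) (h : IsStationary G π) {d : ℕ} (hd : G.IsRegularOfDegree d) :
    minMass π = 1 / Fintype.card V := by
  have := hG.nonempty
  have hn : (Fintype.card V : ℝ) ≠ 0 := by exact_mod_cast Fintype.card_ne_zero
  have hconst : ∃ x, ∀ u, π u = x := by
    rcases subsingleton_or_nontrivial V with hV | hV
    · exact ⟨π (Classical.arbitrary V), fun u => congrArg π (Subsingleton.elim _ _)⟩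
    · obtain ⟨c, -, hc⟩ := h.exists_eq_mul_degree hG
      exact ⟨c * d, fun u => by rw [hc, hd u]⟩
  obtain ⟨x, hx⟩ := hconst
  have hs := h.1.2
  simp only [hx, Finset.sum_const, Finset.card_univ, nsmul_eq_mul] at hs
  simp only [minMass, hx, ciInf_const]
  rw [eq_div_iff hn, mul_comm, hs]

theorem sum_one_div_sqrt_le (s : ℕ) : ∑ t ∈ Finset.range s, 1 / √((t : ℝ) + 1) ≤ 2 * √s := by
  induction s with
  | zero => simp
  | succ s ih =>
    rw [Finset.sum_range_succ, Nat.cast_succ]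
    have h1 : 0 < √((s : ℝ) + 1) := Real.sqrt_pos.2 (by positivity)
    have h2 : √(s : ℝ) ≤ √((s : ℝ) + 1) := Real.sqrt_le_sqrt (by linarith)
    have h3 := Real.sq_sqrt (Nat.cast_nonneg (α := ℝ) s)
    have h4 := Real.sq_sqrt (by positivity : (0 : ℝ) ≤ (s : ℝ) + 1)
    have h5 : 1 / √((s : ℝ) + 1) ≤ 2 * √((s : ℝ) + 1) - 2 * √s := by
      rw [div_le_iff₀ h1]
      nlinarith [sq_nonneg (√((s : ℝ) + 1) - √s)]
    linarith

theorem sum_one_div_succ_le (s : ℕ) :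
    ∑ t ∈ Finset.range s, 1 / ((t : ℝ) + 1) ≤ 1 + Real.log s := by
  have h := harmonic_le_one_add_log s
  simpa [harmonic] using h

variable {G : ℕ → SimpleGraph V} [∀ t, DecidableRel (G t).Adj] {π : V → ℝ}

theorem transProb_eq_stepProd (t : ℕ) :
    transProb G t = stepProd (fun i => lazyMatrix (G i)) t := by
  induction t with
  | zero => rfl
  | succ t ih => rw [transProb, stepProd, ih]

theorem mixingTime_le (hG : ∀ t, (G t).Connected) (hπ : ∀ t, IsStationary (G t) π) :
    mixingTime G π ≤ ENNReal.ofReal (721 * (Fintype.card V / minMass π)) := by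
  have := (hG 0).nonempty
  have hpos := (hπ 0).pos (hG 0)
  have hm := minMass_pos hpos
  have hn : (0 : ℝ) < Fintype.card V := by exact_mod_cast Fintype.card_pos
  have hm1 : minMass π ≤ 1 := by
    rw [← (hπ 0).1.2]
    exact (minMass_le π (Classical.arbitrary V)).trans
      (Finset.single_le_sum (fun w _ => (hpos w).le) (Finset.mem_univ _))
  set N := (Fintype.card V : ℝ) / minMass π with hN
  have hN1 : 1 ≤ N := by
    rw [hN, le_div_iff₀ hm, one_mul]
    exact hm1.trans (by exact_mod_cast Fintype.card_pos)
  have hmN : minMass π * N = Fintype.card V := mul_div_cancel₀ _ hm.ne'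
  set t := ⌈720 * N⌉₊ with ht
  have ht1 : 720 * N ≤ t := Nat.le_ceil _
  have ht2 : (t : ℝ) ≤ 721 * N := by
    have := Nat.ceil_lt_add_one (by positivity : 0 ≤ 720 * N)
    linarith
  refine (iInf₂_le t fun u => ?_).trans ?_
  · rw [l2norm, Real.sqrt_le_left (by norm_num), transProb_eq_stepProd]
    have h := (rowDensity_decay hpos (fun i => (hπ i).isContracting (hG i)) u t).1
    change chiSq π (fun v => stepProd (fun i => lazyMatrix (G i)) t u v / π v) ≤ _
    set y := chiSq π (fun v => stepProd (fun i => lazyMatrix (G i)) t u v / π v)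
    have hy : 0 ≤ y := chiSq_nonneg (fun w => (hpos w).le) _
    have h1 : 720 * N * (minMass π * y) ≤ 80 * Fintype.card V :=
      le_trans (by gcongr) h
    have h2 : Fintype.card V * (720 * y) ≤ Fintype.card V * 80 := by
      calc (Fintype.card V : ℝ) * (720 * y) = 720 * N * (minMass π * y) := by rw [← hmN]; ring
        _ ≤ _ := by linarith
    have h3 := le_of_mul_le_mul_left h2 hn
    linarith
  · rw [← ENNReal.ofReal_natCast]
    exact ENNReal.ofReal_le_ofReal ht2

theorem hittingTime_of_subsingleton [MeasurableSpace V] [DiscreteMeasurableSpace V]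
    [Subsingleton V] (u v : V) : hittingTime G u v = 0 := by
  have : ∀ ω : ℕ → V, firstHit v ω = 0 := fun ω =>
    le_antisymm ((iInf₂_le (0 : ℕ) (Subsingleton.elim (ω 0) v)).trans (by simp)) zero_le
  simp [hittingTime, this]

/-- The window has length about `n log n / π_*`: the bound `n / (π_* t)` on the deviation of the
return probabilities sums up to the length of the window, since `π_* ≥ 1 / n²` keeps the logarithm
of this length of order `log n`. -/
theorem maxHittingTime_le [MeasurableSpace V] [DiscreteMeasurableSpace V]
    (hG : ∀ t, (G t).Connected) (hπ : ∀ t, IsStationary (G t) π) :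
    maxHittingTime G ≤ ENNReal.ofReal
      (48016 * (Fintype.card V * Real.log (Fintype.card V) / minMass π)) := by
  refine iSup₂_le fun u v => ?_
  rcases subsingleton_or_nontrivial V with hV | hV
  · simp [hittingTime_of_subsingleton]
  have hpos := (hπ 0).pos (hG 0)
  have hm := minMass_pos hpos
  have hP := fun i => (hπ i).isContracting (hG i)
  have hPr := fun i => (hP i).toIsReversible
  have hn : (2 : ℝ) ≤ Fintype.card V := by exact_mod_cast Fintype.one_lt_card
  have hm1 : minMass π ≤ 1 := by
    rw [← (hπ 0).1.2]
    exact (minMass_le π v).trans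
      (Finset.single_le_sum (fun w _ => (hpos w).le) (Finset.mem_univ _))
  have hmsq := (hπ 0).one_le_minMass_mul_sq (hG 0)
  set n := (Fintype.card V : ℝ)
  set l := Real.log n with hl
  set N := n / minMass π with hN
  have hl2 : 0.69 ≤ l :=
    le_trans (by linarith [Real.log_two_gt_d9]) (Real.log_le_log (by norm_num) hn)
  have hln : l ≤ n := Real.log_le_self (by linarith)
  have hmN : minMass π * N = n := mul_div_cancel₀ _ hm.ne'
  have hN2 : 2 ≤ N := by
    rw [hN, le_div_iff₀ hm]; linarith
  have hNn : N ≤ n ^ 3 := by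
    rw [hN, div_le_iff₀ hm]; nlinarith
  have hNl : 1 ≤ N * l := by nlinarith
  set s := ⌈3000 * (N * l)⌉₊ with hs
  have hs1 : 3000 * (N * l) ≤ s := Nat.le_ceil _
  have hs2 : (s : ℝ) ≤ 3001 * (N * l) := by
    have := Nat.ceil_lt_add_one (by positivity : 0 ≤ 3000 * (N * l))
    linarith
  have hr1 : (⌈480 * N⌉₊ : ℝ) ≤ 480 * N + 1 :=
    (Nat.ceil_lt_add_one (by positivity : 0 ≤ 480 * N)).le
  have hlog : Real.log s ≤ 16 * l := by
    have h1 : (s : ℝ) ≤ n ^ 16 := by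
      calc (s : ℝ) ≤ 3001 * (N * l) := hs2
        _ ≤ 2 ^ 12 * (n ^ 3 * n) := by gcongr; norm_num
        _ ≤ n ^ 12 * (n ^ 3 * n) := by gcongr
        _ = n ^ 16 := by ring
    have h2 := Real.log_le_log (by nlinarith) h1
    rwa [Real.log_pow] at h2
  have hbound : ∀ a t w, |stepProd (fun i => lazyMatrix (G (a + i))) (t + 1) w v / π v - 1|
      ≤ 240 * N * (1 / ((t : ℝ) + 1)) := fun a t w => by
    refine ((abs_stepProd_div_sub_one_decay hpos (hπ 0).1.2 (fun i => hP (a + i))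
      (Nat.succ_pos t) w v).1).trans_eq ?_
    rw [hN, Nat.cast_succ]
    change 240 * n / (minMass π * (t + 1)) = _
    field_simp
  have key := sum_avoidProb_le_of_decay (v := v) hPr (hpos v) (s := s)
    (r := ⌈480 * N⌉₊) (d := fun t => 240 * N * (1 / ((t : ℝ) + 1))) ?_ ?_
    (fun a t => hbound a t v) ?_ ?_ u
  · refine (hittingTime_le G hG hπ u v key).trans (ENNReal.ofReal_le_ofReal ?_)
    rw [mul_div_right_comm]
    linarith
  · calc (1 : ℝ) ≤ 3000 * (n * l) := by nlinarith
      _ = minMass π * (3000 * (N * l)) := by rw [← hmN]; ring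
      _ ≤ π v * s := mul_le_mul (minMass_le π v) hs1 (by positivity) (hpos v).le
  · have : (2 : ℝ) * ⌈480 * N⌉₊ ≤ s := by nlinarith
    exact_mod_cast this
  · rw [← Finset.mul_sum]
    calc _ ≤ 240 * N * (1 + Real.log s) := by
          gcongr; exact sum_one_div_succ_le s
      _ ≤ 240 * N * (18 * l) := by gcongr; linarith
      _ ≤ 2 * s := by nlinarith
  · intro a t w ht
    refine (hbound a t w).trans ?_
    have h1 : 480 * N ≤ t := (Nat.le_ceil _).trans (by exact_mod_cast ht)
    rw [mul_one_div, div_le_iff₀ (by positivity)]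
    linarith

/-- For regular graphs a window of length of order `n²` suffices, since the bound `n / √t` on the
deviation of the return probabilities sums up to that order without a logarithm. -/
theorem maxHittingTime_le_of_isRegular [MeasurableSpace V] [DiscreteMeasurableSpace V]
    (hG : ∀ t, (G t).Connected) (hπ : ∀ t, IsStationary (G t) π) {d : ℕ}
    (hd : ∀ t, (G t).IsRegularOfDegree d) :
    maxHittingTime G ≤ ENNReal.ofReal (15360 * (Fintype.card V : ℝ) ^ 2) := by
  refine iSup₂_le fun u v => ?_
  have : Nonempty V := ⟨v⟩
  have hpos := (hπ 0).pos (hG 0)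
  have hP := fun i => (hπ i).isContracting (hG i)
  have hPr := fun i => (hP i).toIsReversible
  have hm := (hπ 0).minMass_eq_of_isRegular (hG 0) (hd 0)
  have hn : (1 : ℝ) ≤ Fintype.card V := by exact_mod_cast Fintype.card_pos
  have hbound := fun a t w => abs_stepProd_div_sub_one_decay hpos (hπ 0).1.2 (fun i => hP (a + i))
    (Nat.succ_pos t) w v
  have hcast : ((960 * Fintype.card V ^ 2 : ℕ) : ℝ) = 960 * (Fintype.card V : ℝ) ^ 2 := by
    push_cast; rfl
  have key := sum_avoidProb_le_of_decay (v := v) hPr (hpos v) (s := 960 * Fintype.card V ^ 2)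
    (r := 480 * Fintype.card V ^ 2) (d := fun t => 16 * Fintype.card V * (1 / √((t : ℝ) + 1)))
    ?_ ?_ (fun a t => ?_) ?_ (fun a t w ht => ?_) u
  · refine (hittingTime_le G hG hπ u v key).trans (ENNReal.ofReal_le_ofReal ?_)
    rw [hcast]
    linarith
  · rw [hcast]
    have h1 := minMass_le π v
    rw [hm] at h1
    calc (1 : ℝ) ≤ 960 * Fintype.card V := by linarith
      _ = 1 / Fintype.card V * (960 * (Fintype.card V : ℝ) ^ 2) := by field_simp
      _ ≤ _ := by gcongr
  · omega
  · refine (hbound a t v).2.trans_eq ?_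
    rw [hm]
    push_cast
    field_simp
  · rw [← Finset.mul_sum, hcast]
    have hsq : √(960 * (Fintype.card V : ℝ) ^ 2) ≤ 31 * Fintype.card V :=
      Real.sqrt_le_iff.2 ⟨by positivity, by nlinarith⟩
    have h1 := sum_one_div_sqrt_le (960 * Fintype.card V ^ 2)
    rw [hcast] at h1
    calc _ ≤ 16 * (Fintype.card V : ℝ) * (2 * (31 * Fintype.card V)) := by
          gcongr; exact h1.trans (by gcongr)
      _ ≤ _ := by nlinarith
  · refine (hbound a t w).1.trans ?_
    have h1 : (480 : ℝ) * (Fintype.card V : ℝ) ^ 2 ≤ t := by exact_mod_cast ht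
    rw [hm]
    push_cast
    rw [div_le_iff₀ (by positivity), mul_comm (1 / (Fintype.card V : ℝ)), mul_one_div,
      ← mul_div_assoc, le_div_iff₀ (by positivity)]
    linarith

end Bounds
end DynamicWalk

theorem theorem1 :
    ∃ C : ℝ, 0 < C ∧
      ∀ (V : Type*) [Fintype V] [DecidableEq V] [MeasurableSpace V] [DiscreteMeasurableSpace V]
        (G : ℕ → SimpleGraph V) [∀ t, DecidableRel (G t).Adj] (π : V → ℝ) (m : ℕ),
        (∀ t, (G t).Connected) →
        (∀ t, DynamicWalk.IsStationary (G t) π) →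
        (∀ t, (G t).edgeFinset.card ≤ m) →
        DynamicWalk.mixingTime G π
            ≤ ENNReal.ofReal (C * (Fintype.card V / DynamicWalk.minMass π)) ∧
        (∀ t : ℕ, 1 ≤ t → ∀ u v : V,
          |DynamicWalk.transProb G t u v / π v - 1|
            ≤ C * (m / t + 1 / (DynamicWalk.minMass π * √(t : ℝ)))) ∧
        DynamicWalk.maxHittingTime G
            ≤ ENNReal.ofReal
                (C * (Fintype.card V * Real.log (Fintype.card V) / DynamicWalk.minMass π)) ∧
        ∀ d : ℕ, (∀ t, (G t).IsRegularOfDegree d) →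
          (∀ t : ℕ, 1 ≤ t → ∀ u v : V,
            |DynamicWalk.transProb G t u v / π v - 1| ≤ C * (Fintype.card V / √(t : ℝ))) ∧
          DynamicWalk.maxHittingTime G ≤ ENNReal.ofReal (C * (Fintype.card V : ℝ) ^ 2) := by
  refine ⟨48016, by norm_num, ?_⟩
  intro V _ _ _ _ G _ π m hG hπ _
  have := (hG 0).nonempty
  have hpos := (hπ 0).pos (hG 0)
  have hm := DynamicWalk.minMass_pos hpos
  have hlog : 0 ≤ Real.log (Fintype.card V) := Real.log_natCast_nonneg _
  have hdecay : ∀ t : ℕ, 1 ≤ t → ∀ u v : V, |DynamicWalk.transProb G t u v / π v - 1|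
      ≤ 16 / (DynamicWalk.minMass π * √(t : ℝ)) := fun t ht u v => by
    rw [DynamicWalk.transProb_eq_stepProd]
    exact (DynamicWalk.abs_stepProd_div_sub_one_decay hpos (hπ 0).1.2
      (fun i => (hπ i).isContracting (hG i)) ht u v).2
  refine ⟨(DynamicWalk.mixingTime_le hG hπ).trans (ENNReal.ofReal_le_ofReal ?_), ?_,
    DynamicWalk.maxHittingTime_le hG hπ, fun d hd => ⟨?_,
    (DynamicWalk.maxHittingTime_le_of_isRegular hG hπ hd).trans (ENNReal.ofReal_le_ofReal ?_)⟩⟩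
  · gcongr
    norm_num
  · intro t ht u v
    refine (hdecay t ht u v).trans ?_
    have h1 : (0 : ℝ) ≤ m / t := by positivity
    have h2 : 0 ≤ 1 / (DynamicWalk.minMass π * √(t : ℝ)) := by positivity
    rw [← mul_one_div]
    linarith
  · intro t ht u v
    refine (hdecay t ht u v).trans ?_
    have hn : (0 : ℝ) < Fintype.card V := by exact_mod_cast Fintype.card_pos
    have ht0 : (0 : ℝ) < √(t : ℝ) := Real.sqrt_pos.2 (by exact_mod_cast ht)
    have h2 : 0 ≤ Fintype.card V / √(t : ℝ) := by positivity
    rw [(hπ 0).minMass_eq_of_isRegular (hG 0) (hd 0)]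
    calc 16 / (1 / (Fintype.card V : ℝ) * √(t : ℝ)) = 16 * (Fintype.card V / √(t : ℝ)) := by
          field_simp
      _ ≤ _ := by linarith
  · gcongr
    norm_num
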